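/- Let $\Omega\subseteq\mathbb{C}^n$ be a domain (a nonempty connected open set), and let $(\tilde\Omega,\pi)$, with $\alpha\colon\Omega\to\tilde\Omega$, be its envelope of holomorphy: $\tilde\Omega$ is a connected Stein manifold of dimension $n$, $\pi\colon\tilde\Omega\to\mathbb{C}^n$ is locally biholomorphic, $\alpha$ is holomorphic with $\pi\circ\alpha=\mathrm{id}_\Omega$, and for each holomorphic function $f$ on $\Omega$ there is a unique holomorphic function $F$ on $\tilde\Omega$ with $f=F\circ\alpha$. Put $\Omega'=\pi(\tilde\Omega)$ and $i=\pi\circ\alpha\colon\Omega\to\Omega'$. Suppose that $\pi\colon\tilde\Omega\to\Omega'$ is a normal covering map (a covering map whose deck transformations act transitively on each fibre), with deck transformation group $H$. If there exists a nonzero abelian quotient $G$ of $H$ such that the induced map $i^*\colon H^1(\Omega';G)\to H^1(\Omega;G)$ on singular cohomology is injective, then $(\tilde\Omega,\pi)$ is schlicht, i.e. $\pi\colon\tilde\Omega\to\Omega'$ is biholomorphic. -/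

import Mathlib

open scoped Manifold ContDiff

universe u v w

noncomputable section

/-! ### Singular cohomology in degree one -/

section Cohomology

/-- The `i`-th face inclusion `Δⁿ → Δⁿ⁺¹` of standard simplices. -/
def faceInclusion (n : ℕ) (i : Fin (n + 2)) :
    C(stdSimplex ℝ (Fin (n + 1)), stdSimplex ℝ (Fin (n + 2))) where
  toFun := stdSimplex.map i.succAbove
  continuous_toFun := stdSimplex.continuous_map _

/-- Singular `n`-simplices of `X`: continuous maps `Δⁿ → X`. -/
abbrev SingularSimplex (n : ℕ) (X : Type u) [TopologicalSpace X] : Type u :=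
  C(stdSimplex ℝ (Fin (n + 1)), X)

/-- Singular `n`-cochains of `X` with coefficients in `G`, i.e. homomorphisms to `G` from the free
abelian group on the singular `n`-simplices, written as functions on the simplices. -/
abbrev SingularCochain (n : ℕ) (X : Type u) [TopologicalSpace X] (G : Type v) : Type (max u v) :=
  SingularSimplex n X → G

/-- The singular coboundary `(δφ)(σ) = ∑ᵢ (-1)ⁱ φ(σ ∘ dᵢ)`. -/
def singularCoboundary (n : ℕ) (X : Type u) [TopologicalSpace X] (G : Type v) [AddCommGroup G] :
    SingularCochain n X G →+ SingularCochain (n + 1) X G where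
  toFun φ σ := ∑ i : Fin (n + 2), (-1 : ℤ) ^ (i : ℕ) • φ (σ.comp (faceInclusion n i))
  map_zero' := by
    ext σ
    simp
  map_add' φ ψ := by
    ext σ
    simp [Finset.sum_add_distrib]

lemma faceInclusion_comp_of_eq {n : ℕ} {i i' : Fin (n + 3)} {j j' : Fin (n + 2)}
    (h : ∀ k, i.succAbove (j.succAbove k) = i'.succAbove (j'.succAbove k)) :
    (faceInclusion (n + 1) i).comp (faceInclusion n j) =
      (faceInclusion (n + 1) i').comp (faceInclusion n j') := by
  ext1 x
  change stdSimplex.map i.succAbove (stdSimplex.map j.succAbove x) =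
    stdSimplex.map i'.succAbove (stdSimplex.map j'.succAbove x)
  rw [stdSimplex.map_comp_apply, stdSimplex.map_comp_apply]
  exact congrArg (fun g => stdSimplex.map g x) (funext h)

lemma singularCoboundary_one_zero (X : Type u) [TopologicalSpace X] (G : Type v) [AddCommGroup G]
    (φ : SingularCochain 0 X G) :
    singularCoboundary 1 X G (singularCoboundary 0 X G φ) = 0 := by
  have h1 : (faceInclusion 1 1).comp (faceInclusion 0 0) =
      (faceInclusion 1 0).comp (faceInclusion 0 0) := faceInclusion_comp_of_eq (by decide)
  have h2 : (faceInclusion 1 2).comp (faceInclusion 0 0) =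
      (faceInclusion 1 0).comp (faceInclusion 0 1) := faceInclusion_comp_of_eq (by decide)
  have h3 : (faceInclusion 1 2).comp (faceInclusion 0 1) =
      (faceInclusion 1 1).comp (faceInclusion 0 1) := faceInclusion_comp_of_eq (by decide)
  ext σ
  simp only [singularCoboundary, AddMonoidHom.coe_mk, ZeroHom.coe_mk, Fin.sum_univ_succ,
    Finset.univ_eq_empty, Finset.sum_empty, ContinuousMap.comp_assoc]
  simp [h1, h2, h3]
  abel

/-- Singular `1`-cocycles. -/
def singularZ1 (X : Type u) [TopologicalSpace X] (G : Type v) [AddCommGroup G] :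
    AddSubgroup (SingularCochain 1 X G) :=
  (singularCoboundary 1 X G).ker

/-- Singular `1`-coboundaries, as a subgroup of the `1`-cocycles. -/
def singularB1 (X : Type u) [TopologicalSpace X] (G : Type v) [AddCommGroup G] :
    AddSubgroup (singularZ1 X G) :=
  ((singularCoboundary 0 X G).codRestrict (singularZ1 X G)
    fun φ => singularCoboundary_one_zero X G φ).range

/-- The first singular cohomology group `H¹(X; G)`. -/
abbrev SingularH1 (X : Type u) [TopologicalSpace X] (G : Type v) [AddCommGroup G] :
    Type (max u v) :=
  singularZ1 X G ⧸ singularB1 X G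

variable {X : Type u} {Y : Type w} [TopologicalSpace X] [TopologicalSpace Y]

/-- Pullback of singular cochains along a continuous map. -/
def cochainPullback (n : ℕ) (f : C(X, Y)) (G : Type v) [AddCommGroup G] :
    SingularCochain n Y G →+ SingularCochain n X G where
  toFun φ σ := φ (f.comp σ)
  map_zero' := rfl
  map_add' _ _ := rfl

lemma singularCoboundary_pullback (n : ℕ) (f : C(X, Y)) (G : Type v) [AddCommGroup G]
    (φ : SingularCochain n Y G) :
    singularCoboundary n X G (cochainPullback n f G φ) =
      cochainPullback (n + 1) f G (singularCoboundary n Y G φ) :=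
  rfl

/-- Pullback of singular `1`-cocycles along a continuous map. -/
def cocyclePullback (f : C(X, Y)) (G : Type v) [AddCommGroup G] :
    singularZ1 Y G →+ singularZ1 X G :=
  ((cochainPullback 1 f G).comp (singularZ1 Y G).subtype).codRestrict (singularZ1 X G) fun c => by
    change singularCoboundary 1 X G (cochainPullback 1 f G c) = 0
    rw [singularCoboundary_pullback, show singularCoboundary 1 Y G c = 0 from c.2, map_zero]

lemma singularB1_le_comap (f : C(X, Y)) (G : Type v) [AddCommGroup G] :
    singularB1 Y G ≤ (singularB1 X G).comap (cocyclePullback f G) := by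
  rintro _ ⟨φ, rfl⟩
  exact ⟨cochainPullback 0 f G φ, rfl⟩

/-- The homomorphism `f^* : H¹(Y; G) → H¹(X; G)` induced by a continuous map `f : X → Y`. -/
def singularH1Map (f : C(X, Y)) (G : Type v) [AddCommGroup G] :
    SingularH1 Y G →+ SingularH1 X G :=
  QuotientAddGroup.map _ _ (cocyclePullback f G) (singularB1_le_comap f G)

end Cohomology

/-! ### Normal coverings -/

section Coverings

variable {X : Type u} {Y : Type w} [TopologicalSpace X] [TopologicalSpace Y]

/-- The group of deck transformations of `p : X → Y`: self-homeomorphisms of `X` over `Y`. -/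
def deckGroup (p : X → Y) : Subgroup (X ≃ₜ X) where
  carrier := {h | ∀ x, p (h x) = p x}
  mul_mem' {a b} ha hb x := (ha (b x)).trans (hb x)
  one_mem' _ := rfl
  inv_mem' {a} ha x := by
    have h := ha (a⁻¹ x)
    rw [show a (a⁻¹ x) = x from a.apply_symm_apply x] at h
    exact h.symm

/-- A covering map is normal if its deck transformations act transitively on every fibre. -/
structure IsNormalCoveringMap (p : X → Y) : Prop where
  isCoveringMap : IsCoveringMap p
  exists_deck : ∀ x x' : X, p x = p x' → ∃ h ∈ deckGroup p, h x = x'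

end Coverings

/-! ### Stein manifolds and envelopes of holomorphy -/

section Envelope

/-- The complex coordinate space `ℂⁿ`. -/
abbrev CSpace (n : ℕ) : Type := EuclideanSpace ℂ (Fin n)

variable {n : ℕ}

/-- Holomorphic functions on a complex manifold of dimension `n`. -/
def IsHolomorphicFun {X : Type u} [TopologicalSpace X] [ChartedSpace (CSpace n) X]
    (f : X → ℂ) : Prop :=
  MDifferentiable 𝓘(ℂ, CSpace n) 𝓘(ℂ, ℂ) f

/-- The holomorphically convex hull of `K`: the points `x` with `|f(x)| ≤ sup_K |f|` for every
holomorphic function `f` on the manifold. -/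
def holomorphicHull (n : ℕ) {X : Type u} [TopologicalSpace X] [ChartedSpace (CSpace n) X]
    (K : Set X) : Set X :=
  {x | ∀ f : X → ℂ, IsHolomorphicFun (n := n) f → ∀ C : ℝ, (∀ y ∈ K, ‖f y‖ ≤ C) → ‖f x‖ ≤ C}

/-- A Stein manifold of dimension `n`: a Hausdorff, second countable complex manifold that is
holomorphically convex and holomorphically separable. -/
structure IsSteinManifold (n : ℕ) (X : Type u) [TopologicalSpace X]
    [ChartedSpace (CSpace n) X] : Prop where
  isManifold : IsManifold 𝓘(ℂ, CSpace n) ω X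
  t2Space : T2Space X
  secondCountable : SecondCountableTopology X
  convex : ∀ K : Set X, IsCompact K → IsCompact (holomorphicHull n K)
  separable : ∀ x y : X, x ≠ y → ∃ f : X → ℂ, IsHolomorphicFun (n := n) f ∧ f x ≠ f y

/-- `(X, π)` together with `α : Ω → X` is an envelope of holomorphy of the open set `Ω ⊆ ℂⁿ`. -/
structure IsEnvelopeOfHolomorphy (Ω : TopologicalSpace.Opens (CSpace n)) {X : Type u}
    [TopologicalSpace X] [ChartedSpace (CSpace n) X] (π : X → CSpace n) (α : Ω → X) : Prop where
  connected : ConnectedSpace X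
  stein : IsSteinManifold n X
  isLocalDiffeomorph : IsLocalDiffeomorph 𝓘(ℂ, CSpace n) 𝓘(ℂ, CSpace n) ω π
  holomorphic : MDifferentiable 𝓘(ℂ, CSpace n) 𝓘(ℂ, CSpace n) α
  proj_comp : ∀ z : Ω, π (α z) = z
  existsUnique_extension : ∀ f : Ω → ℂ, IsHolomorphicFun (n := n) f →
    ∃! F : X → ℂ, IsHolomorphicFun (n := n) F ∧ ∀ z : Ω, F (α z) = f z

namespace IsEnvelopeOfHolomorphy

variable {Ω : TopologicalSpace.Opens (CSpace n)} {X : Type u} [TopologicalSpace X]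
  [ChartedSpace (CSpace n) X] {π : X → CSpace n} {α : Ω → X}

/-- The open set `Ω' = π(X) ⊆ ℂⁿ`. -/
def image (h : IsEnvelopeOfHolomorphy Ω π α) : TopologicalSpace.Opens (CSpace n) where
  carrier := Set.range π
  is_open' := h.isLocalDiffeomorph.isOpen_range

/-- `π` regarded as a map `X → Ω'`. -/
def proj (h : IsEnvelopeOfHolomorphy Ω π α) : X → h.image :=
  fun x => ⟨π x, Set.mem_range_self x⟩

/-- The continuous map `i = π ∘ α : Ω → Ω'`. -/
def incl (h : IsEnvelopeOfHolomorphy Ω π α) : C(Ω, h.image) where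
  toFun z := h.proj (α z)
  continuous_toFun :=
    (h.isLocalDiffeomorph.contMDiff.continuous.comp h.holomorphic.continuous).subtype_mk _

/-- The envelope is schlicht if `π : X → Ω'` is biholomorphic. -/
def IsSchlicht (h : IsEnvelopeOfHolomorphy Ω π α) : Prop :=
  ∃ Φ : Diffeomorph 𝓘(ℂ, CSpace n) 𝓘(ℂ, CSpace n) X h.image ω, ∀ x, Φ x = h.proj x

end IsEnvelopeOfHolomorphy

end Envelope

end

/-! ### Deck transformations and descent of cochains along a normal covering -/

section Descent

variable {X : Type u} {Y : Type w} [TopologicalSpace X] [TopologicalSpace Y]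

/-! A character `q` of the deck group is the obstruction class of the covering `p`. Label the points
of `X` by a function `κ`, in general discontinuous, with `κ (g x) = q g + κ x`. The constants cancel
in `δκ`, so `δκ` is deck invariant and descends to a cocycle `c` on the base
(`IsNormalCoveringMap.exists_cochainPullback_eq`). Since `i` factors through `p`, the pullback
`i^*c` is the coboundary of `α^*κ`, and injectivity of `i^*` forces `c = δφ`. Then `κ - p^*φ` is a
`0`-cocycle on a path-connected space, hence constant. As `p^*φ` is deck invariant, so is `κ`, and
`q` is trivial. A surjective `q` thus has zero target, and a trivial deck group acting transitively
on fibres makes `π` injective. -/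

instance contractibleSpace_stdSimplex (n : ℕ) :
    ContractibleSpace (stdSimplex ℝ (Fin (n + 1))) :=
  (convex_stdSimplex ℝ (Fin (n + 1))).contractibleSpace
    ⟨_, single_mem_stdSimplex ℝ (0 : Fin (n + 1))⟩

/-- A deck transformation of a connected covering space is determined by its value at a point. -/
lemma IsCoveringMap.deckGroup_ext [PreconnectedSpace X] {p : X → Y} (hp : IsCoveringMap p)
    {a b : deckGroup p} (x : X) (h : (a : X ≃ₜ X) x = (b : X ≃ₜ X) x) : a = b := by
  refine Subtype.ext (Homeomorph.ext fun y => ?_)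
  refine congrFun (hp.eq_of_comp_eq (a : X ≃ₜ X).continuous (b : X ≃ₜ X).continuous ?_ x h) y
  ext z
  exact (a.2 z).trans (b.2 z).symm

/-- Maps from a contractible space lift along a surjective covering map. -/
lemma IsCoveringMap.exists_lift_of_contractible {A : Type*} [TopologicalSpace A]
    [ContractibleSpace A] {p : C(X, Y)} (hp : IsCoveringMap p) (hsurj : Function.Surjective p)
    (σ : C(A, Y)) : ∃ τ : C(A, X), p.comp τ = σ := by
  obtain ⟨a, ⟨F⟩⟩ := id_nullhomotopic A
  obtain ⟨x, hx⟩ := hsurj (σ a)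
  -- The contraction is run backwards, from a constant map to the identity: its start lifts to the
  -- constant `x`, and the end of the lifted homotopy lifts `σ`.
  let K : C(unitInterval × A, Y) := σ.comp F.symm.toContinuousMap
  have hK : ∀ b, K (0, b) = p (ContinuousMap.const A x b) := fun b => by
    change σ (F.symm (0, b)) = p x
    rw [F.symm.apply_zero, hx]
    rfl
  refine ⟨(hp.liftHomotopy K (.const A x) hK).comp ((ContinuousMap.const A 1).prodMk (.id A)), ?_⟩
  ext b
  refine (congrFun (hp.liftHomotopy_lifts K (.const A x) hK) (1, b)).trans ?_
  change σ (F.symm (1, b)) = σ b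
  rw [F.symm.apply_one]
  rfl

/-- Two lifts of a map from a connected space along a normal covering differ by a deck
transformation. -/
lemma IsNormalCoveringMap.exists_deck_comp_eq {A : Type*} [TopologicalSpace A]
    [ConnectedSpace A] {p : C(X, Y)} (hp : IsNormalCoveringMap p) {τ τ' : C(A, X)}
    (h : p.comp τ = p.comp τ') :
    ∃ g : deckGroup p, ((g : X ≃ₜ X) : C(X, X)).comp τ = τ' := by
  obtain ⟨a⟩ := (inferInstance : Nonempty A)
  obtain ⟨g, hg, hga⟩ := hp.exists_deck (τ a) (τ' a) (DFunLike.congr_fun h a)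
  refine ⟨⟨g, hg⟩, DFunLike.coe_injective (hp.isCoveringMap.eq_of_comp_eq
    (ContinuousMap.continuous _) τ'.continuous ?_ a hga)⟩
  ext b
  exact (hg (τ b)).trans (DFunLike.congr_fun h b)

/-- Simplices are contractible, so every simplex of the base is the image of one upstairs. -/
lemma IsCoveringMap.cochainPullback_injective {p : C(X, Y)} (hp : IsCoveringMap p)
    (hsurj : Function.Surjective p) (n : ℕ) (G : Type v) [AddCommGroup G] :
    Function.Injective (cochainPullback n p G) := by
  intro φ ψ h
  ext σ
  obtain ⟨τ, rfl⟩ := hp.exists_lift_of_contractible hsurj σ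
  exact congrFun h τ

/-- A cochain invariant under the deck transformations of a normal covering is pulled back from
the base. -/
lemma IsNormalCoveringMap.exists_cochainPullback_eq {p : C(X, Y)} (hp : IsNormalCoveringMap p)
    (hsurj : Function.Surjective p) {n : ℕ} {G : Type v} [AddCommGroup G]
    (ψ : SingularCochain n X G)
    (hψ : ∀ (g : deckGroup p) (τ : SingularSimplex n X),
      ψ (((g : X ≃ₜ X) : C(X, X)).comp τ) = ψ τ) :
    ∃ φ : SingularCochain n Y G, cochainPullback n p G φ = ψ := by
  choose lift hlift using fun σ : SingularSimplex n Y =>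
    hp.isCoveringMap.exists_lift_of_contractible hsurj σ
  -- The choice of lift is harmless: two lifts differ by a deck transformation, which preserves `ψ`.
  refine ⟨fun σ => ψ (lift σ), funext fun τ => ?_⟩
  obtain ⟨g, hg⟩ := hp.exists_deck_comp_eq (hlift (p.comp τ))
  exact (hψ g _).symm.trans (congrArg ψ hg)

/-- For every homomorphism `q` from the deck group of a connected normal covering to an abelian
group `G` there is a function on the total space which `h` translates by `q h`. -/
lemma IsNormalCoveringMap.exists_equivariant [PreconnectedSpace X] {p : X → Y}
    (hp : IsNormalCoveringMap p) (hsurj : Function.Surjective p) {G : Type v} [AddCommGroup G]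
    (q : deckGroup p →* Multiplicative G) :
    ∃ κ : X → G, ∀ (g : deckGroup p) (x : X),
      κ ((g : X ≃ₜ X) x) = (q g).toAdd + κ x := by
  -- `surjInv` picks a base point in each fibre; `k x` will be the deck transformation carrying it
  -- to `x`.
  have hex (x : X) :
      ∃ k : deckGroup p, (k : X ≃ₜ X) (Function.surjInv hsurj (p x)) = x := by
    obtain ⟨k, hk, hkx⟩ := hp.exists_deck _ x (Function.surjInv_eq hsurj (p x))
    exact ⟨⟨k, hk⟩, hkx⟩
  choose k hk using hex
  refine ⟨fun x => (q (k x)).toAdd, fun g x => ?_⟩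
  have hgx : k ((g : X ≃ₜ X) x) = g * k x := by
    refine hp.isCoveringMap.deckGroup_ext (Function.surjInv hsurj (p x)) ?_
    have h1 := hk ((g : X ≃ₜ X) x)
    rw [g.2 x] at h1
    rw [h1]
    exact (congrArg (g : X ≃ₜ X) (hk x)).symm
  simp only [hgx, map_mul, toAdd_mul]

end Descent

/-! ### Low-dimensional singular cochains -/

section LowDimension

variable {X : Type u} [TopologicalSpace X] {G : Type v} [AddCommGroup G]

/-- The `0`-cochain given by a function on points. -/
def zeroCochain (κ : X → G) : SingularCochain 0 X G :=
  fun σ => κ (σ default)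

lemma singularCoboundary_zero_apply (φ : SingularCochain 0 X G) (σ : SingularSimplex 1 X) :
    singularCoboundary 0 X G φ σ =
      φ (.const _ (σ (stdSimplex.vertex 1))) - φ (.const _ (σ (stdSimplex.vertex 0))) := by
  -- The `i`-th face of an edge omits vertex `i`, so the end vertex `1` is face `0` and carries the
  -- plus sign.
  have key (i j : Fin 2) (hij : i.succAbove (0 : Fin 1) = j) :
      σ.comp (faceInclusion 0 i) = .const _ (σ (stdSimplex.vertex j)) := by
    ext x
    change σ (stdSimplex.map i.succAbove x) = σ (stdSimplex.vertex j)
    rw [Subsingleton.elim x (stdSimplex.vertex (0 : Fin 1)), stdSimplex.map_vertex, hij]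
  have h0 := key 0 1 rfl
  have h1 := key 1 0 rfl
  change ∑ i : Fin 2, (-1 : ℤ) ^ (i : ℕ) • φ (σ.comp (faceInclusion 0 i)) = _
  rw [Fin.sum_univ_two, h0, h1]
  simp [sub_eq_add_neg]

/-- On a path-connected space, a `0`-cocycle takes the same value at any two points. -/
lemma apply_const_eq_of_singularCoboundary_eq_zero [PathConnectedSpace X]
    {φ : SingularCochain 0 X G} (hφ : singularCoboundary 0 X G φ = 0) (x y : X) :
    φ (.const _ x) = φ (.const _ y) := by
  let γ : Path x y := PathConnectedSpace.somePath x y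
  let σ : SingularSimplex 1 X :=
    (γ : C(unitInterval, X)).comp (stdSimplexHomeomorphUnitInterval : C(_, unitInterval))
  have hσ0 : σ (stdSimplex.vertex 0) = x :=
    (congrArg γ stdSimplexHomeomorphUnitInterval_zero).trans γ.source
  have hσ1 : σ (stdSimplex.vertex 1) = y :=
    (congrArg γ stdSimplexHomeomorphUnitInterval_one).trans γ.target
  have h := congrFun hφ σ
  rw [singularCoboundary_zero_apply, hσ0, hσ1] at h
  exact (sub_eq_zero.mp h).symm

end LowDimension

/-! ### The obstruction class of a normal covering -/

section Obstruction

variable {X : Type u} {Y : Type w} [TopologicalSpace X] [TopologicalSpace Y]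

/-- Let `p : X → Y` be a normal covering with `X` path connected and let `f : A → Y` lift to `X`.
A homomorphism `q` from the deck group to `G` gives a class in `H¹(Y; G)` which `p`, hence `f`,
pulls back to zero, and which vanishes only if `q` is trivial. -/
theorem IsNormalCoveringMap.hom_eq_one_of_singularH1Map_injective [PathConnectedSpace X]
    {A : Type*} [TopologicalSpace A] {p : C(X, Y)} (hp : IsNormalCoveringMap p)
    (hsurj : Function.Surjective p) (α : C(A, X)) {G : Type v} [AddCommGroup G]
    (hinj : Function.Injective (singularH1Map (p.comp α) G))
    (q : deckGroup p →* Multiplicative G) : q = 1 := by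
  obtain ⟨κ, hκ⟩ := hp.exists_equivariant hsurj q
  obtain ⟨c, hc⟩ := hp.exists_cochainPullback_eq hsurj
    (singularCoboundary 0 X G (zeroCochain κ)) fun g τ => by
      simp only [singularCoboundary_zero_apply, zeroCochain, ContinuousMap.const_apply,
        ContinuousMap.comp_apply, ContinuousMap.coe_coe, hκ, add_sub_add_left_eq_sub]
  have hc_mem : c ∈ singularZ1 Y G := by
    -- The cocycle condition may be checked upstairs, where `c` becomes `δκ`.
    refine hp.isCoveringMap.cochainPullback_injective hsurj 2 G ?_
    rw [← singularCoboundary_pullback, hc, singularCoboundary_one_zero, map_zero]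
  have hzero : singularH1Map (p.comp α) G (QuotientAddGroup.mk ⟨c, hc_mem⟩) = 0 := by
    refine (QuotientAddGroup.eq_zero_iff _).mpr
      ⟨cochainPullback 0 α G (zeroCochain κ), Subtype.ext ?_⟩
    exact congrArg (cochainPullback 1 α G) hc.symm
  obtain ⟨φ, hφ⟩ := (QuotientAddGroup.eq_zero_iff _).mp (hinj (hzero.trans (map_zero _).symm))
  have hφc : singularCoboundary 0 Y G φ = c := congrArg Subtype.val hφ
  have hcocycle :
      singularCoboundary 0 X G (zeroCochain κ - cochainPullback 0 p G φ) = 0 := by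
    rw [map_sub, singularCoboundary_pullback, hφc, hc, sub_self]
  ext g
  obtain ⟨x⟩ := (inferInstance : Nonempty X)
  have h := apply_const_eq_of_singularCoboundary_eq_zero hcocycle ((g : X ≃ₜ X) x) x
  -- The `φ` terms at `g x` and `x` agree, which leaves `q g + κ x = κ x`.
  have hconst : p.comp (.const (stdSimplex ℝ (Fin 1)) ((g : X ≃ₜ X) x)) =
      p.comp (.const (stdSimplex ℝ (Fin 1)) x) := by
    ext b
    exact g.2 x
  have h' : κ ((g : X ≃ₜ X) x) - φ (p.comp (.const _ ((g : X ≃ₜ X) x))) =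
      κ x - φ (p.comp (.const _ x)) := h
  rw [hconst, sub_left_inj, hκ] at h'
  exact add_eq_right.mp h'

end Obstruction

/-! ### Schlicht envelopes -/

namespace IsEnvelopeOfHolomorphy

variable {n : ℕ} {Ω : TopologicalSpace.Opens (CSpace n)} {X : Type u} [TopologicalSpace X]
  [ChartedSpace (CSpace n) X] {π : X → CSpace n} {α : Ω → X}

lemma proj_surjective (h : IsEnvelopeOfHolomorphy Ω π α) : Function.Surjective h.proj := by
  rintro ⟨_, x, rfl⟩
  exact ⟨x, rfl⟩

/-- The global inverse agrees near each point with a local inverse of `π`, so it is analytic. -/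
theorem isSchlicht_of_injective (h : IsEnvelopeOfHolomorphy Ω π α)
    (hinj : Function.Injective h.proj) : h.IsSchlicht := by
  let e : X ≃ h.image := Equiv.ofBijective h.proj ⟨hinj, h.proj_surjective⟩
  refine ⟨⟨e, ?_, ?_⟩, fun _ => rfl⟩
  · exact fun x => (ChartedSpace.liftPropWithinAt_subtypeVal_comp_iff ..).mp
      (h.isLocalDiffeomorph.contMDiff x)
  · intro y
    have hloc := h.isLocalDiffeomorph (e.symm y)
    have hy : π (e.symm y) = y := congrArg Subtype.val (e.apply_symm_apply y)
    have hsmooth : ContMDiffAt 𝓘(ℂ, CSpace n) 𝓘(ℂ, CSpace n) ω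
        (fun z : h.image => hloc.localInverse (z : CSpace n)) y := by
      refine ContMDiffAt.comp y ?_ (contMDiff_subtype_val y)
      rw [← hy]
      exact hloc.localInverse_contMDiffAt
    refine hsmooth.congr_of_eventuallyEq ?_
    have hev : ∀ᶠ z : CSpace n in nhds (y : CSpace n), π (hloc.localInverse z) = z := by
      rw [← hy]
      exact hloc.localInverse_eventuallyEq_right
    filter_upwards [continuous_subtype_val.continuousAt.eventually hev] with z hz
    -- A local right inverse of `π` must be `e.symm`, because `e` is a bijection.
    exact e.symm_apply_eq.mpr (Subtype.ext hz.symm)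

/-- If `X → Ω'` is a normal covering, `i^*` is injective on `H¹(-; G)`, and `G` is an abelian
quotient of the deck group that is zero only if the deck group is trivial, then the envelope is
schlicht. -/
theorem isSchlicht_of_singularH1Map_injective (h : IsEnvelopeOfHolomorphy Ω π α)
    (hnormal : IsNormalCoveringMap h.proj) {G : Type v} [AddCommGroup G]
    {q : deckGroup h.proj →* Multiplicative G} (hq : Function.Surjective q)
    (hG : Subsingleton G → Subsingleton (deckGroup h.proj))
    (hinj : Function.Injective (singularH1Map h.incl G)) : h.IsSchlicht := by
  have := h.connected
  -- A connected manifold is path connected, as the constancy of `0`-cocycles requires.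
  have : LocallyPathConnectedSpace X := ChartedSpace.locallyPathConnectedSpace (CSpace n) X
  have : PathConnectedSpace X := pathConnectedSpace_iff_connectedSpace.mpr inferInstance
  let p : C(X, h.image) := ⟨h.proj, hnormal.isCoveringMap.continuous⟩
  have hq1 : q = 1 := IsNormalCoveringMap.hom_eq_one_of_singularH1Map_injective (p := p)
    hnormal h.proj_surjective ⟨α, h.holomorphic.continuous⟩ hinj q
  have hzero (a : G) : a = 0 := by
    obtain ⟨g, hg⟩ := hq (Multiplicative.ofAdd a)
    rw [hq1] at hg
    exact (congrArg Multiplicative.toAdd hg).symm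
  have hdeck := hG ⟨fun a b => (hzero a).trans (hzero b).symm⟩
  -- Points of one fibre are related by a deck transformation, now the identity.
  refine h.isSchlicht_of_injective fun x x' hx => ?_
  obtain ⟨g, hg, hgx⟩ := hnormal.exists_deck x x' hx
  have hg1 : g = 1 := congrArg Subtype.val (Subsingleton.elim (⟨g, hg⟩ : deckGroup h.proj) 1)
  rw [← hgx, hg1]
  rfl

end IsEnvelopeOfHolomorphy

/-- A nonzero abelian quotient `G` of the deck group and injectivity of `i^*` on `H¹(-; G)` cannot
occur together: by `IsNormalCoveringMap.hom_eq_one_of_singularH1Map_injective`, a nonzero quotient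
gives a nonzero class in the kernel of `i^*`. The statement is therefore proved through
`IsEnvelopeOfHolomorphy.isSchlicht_of_singularH1Map_injective`, which has the weaker hypothesis
that `G` is nonzero unless the deck group is trivial and also covers schlicht envelopes. -/
theorem mainTheorem4 {n : ℕ} (Ω : TopologicalSpace.Opens (CSpace n))
    (hΩ : IsConnected (Ω : Set (CSpace n)))
    {X : Type u} [TopologicalSpace X] [ChartedSpace (CSpace n) X]
    (π : X → CSpace n) (α : Ω → X) (h : IsEnvelopeOfHolomorphy Ω π α)
    (hnormal : IsNormalCoveringMap h.proj)
    (hG : ∃ (G : Type v) (_ : AddCommGroup G) (_ : Nontrivial G)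
      (q : deckGroup h.proj →* Multiplicative G), Function.Surjective q ∧
        Function.Injective (singularH1Map h.incl G)) :
    h.IsSchlicht := by
  obtain ⟨G, _, _, q, hq, hinj⟩ := hG
  exact h.isSchlicht_of_singularH1Map_injective hnormal hq
    (fun hs => (not_subsingleton G hs).elim) hinj
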